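/- Let $k$ be an algebraically closed field and let $\mathcal{C}$ be a $k$-linear triangulated category with split idempotents and suspension functor $\Sigma$. Assume that $\mathcal{C}$ is Hom-finite (all $\mathcal{C}(X,Y)$ are finite-dimensional over $k$) and 2-Calabi--Yau (there are bifunctorial $k$-linear isomorphisms $\mathcal{C}(X,\Sigma Y)\simeq \operatorname{Hom}_k(\mathcal{C}(Y,\Sigma X),k)$). Let $T$ be a cluster-tilting object of $\mathcal{C}$: $\mathcal{C}(T,\Sigma T)=0$, and every $X$ with $\mathcal{C}(X,\Sigma T)=0$ belongs to $\operatorname{add}T$, the full subcategory of direct summands of finite direct sums of copies of $T$. Let $F=\mathcal{C}(T,?)$, a functor from $\mathcal{C}$ to finite-dimensional right $\operatorname{End}_{\mathcal{C}}(T)$-modules. For an object $Y$, write $(Y)$ for the ideal of morphisms of $\mathcal{C}$ that factor through a finite direct sum of copies of $Y$. For a triangle $M\xrightarrow{i}B\xrightarrow{p}L\xrightarrow{\varepsilon}\Sigma M$ and morphisms $i_U:U\to M$, $i_V:V\to L$ such that $Fi_U$ and $Fi_V$ are monomorphisms (so that $FU$ and $FV$ are identified with submodules of $FM$ and $FL$),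 consider the conditions: (i) there is a submodule $E\subset FB$ such that $FV=(Fp)E$ and $FU=(Fi)^{-1}E$; (ii) there are morphisms $e:\Sigma^{-1}V\to U$ and $f:\Sigma^{-1}L\to U$ such that (a) $(\Sigma^{-1}\varepsilon)(\Sigma^{-1}i_V)=i_U e$, (b) $e\in(T)$, and (c) $i_U f-\Sigma^{-1}\varepsilon\in(\Sigma T)$; (iii) there are $e$ and $f$ as in (ii) which moreover satisfy $e=f\,\Sigma^{-1}i_V$. Now let $L,M\in\mathcal{C}$ be such that $\dim_k\mathcal{C}(L,\Sigma M)=1$, let $$\Delta: M\xrightarrow{i}B\xrightarrow{p}L\xrightarrow{\varepsilon}\Sigma M\quad\text{and}\quad \Delta': L\xrightarrow{i'}B'\xrightarrow{p'}M\xrightarrow{\varepsilon'}\Sigma L$$ be non-split triangles (i.e. $\varepsilon\neq0$ and $\varepsilon'\neq0$), and let $i_U:U\to M$ and $i_V:V\to L$ be morphisms whose images under $F$ are monomorphisms. Then conditions (i), (ii), (iii) for $\Delta$ and the pair $(i_U,i_V)$ are equivalent to each other, conditions (i), (ii), (iii) for $\Delta'$ and the pair $(i_V,i_U)$ (that is,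 with the roles of $M,U$ and of $L,V$ exchanged) are equivalent to each other, and each of these conditions holds for $\Delta$ if and only if it does not hold for $\Delta'$. -/

import Mathlib

open CategoryTheory Limits Pretriangulated

universe w v u

noncomputable section

namespace TwoCY

/-- `𝒞` is 2-Calabi–Yau over `k`: there are `k`-linear isomorphisms
`𝒞(X, ΣY) ≃ D 𝒞(Y, ΣX)`, with `D = Hom_k(?, k)`, natural in `X` and in `Y`. -/
def IsTwoCalabiYau (k : Type w) [Field k] (C : Type u) [Category.{v} C] [Preadditive C]
    [Linear k C] [HasShift C ℤ] : Prop :=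
  ∃ φ : ∀ X Y : C, (X ⟶ Y⟦(1 : ℤ)⟧) ≃ₗ[k] Module.Dual k (Y ⟶ X⟦(1 : ℤ)⟧),
    ∀ (X X' Y Y' : C) (f : X' ⟶ X) (g : Y ⟶ Y') (a : X ⟶ Y⟦(1 : ℤ)⟧) (b : Y' ⟶ X'⟦(1 : ℤ)⟧),
      φ X' Y' (f ≫ a ≫ g⟦(1 : ℤ)⟧') b = φ X Y a (g ≫ b ≫ f⟦(1 : ℤ)⟧')

section

variable {C : Type u} [Category.{v} C] [Preadditive C] [HasFiniteBiproducts C]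

/-- `X` lies in `add T`: it is a direct summand of a finite direct sum of copies of `T`. -/
def InAdd (T X : C) : Prop :=
  ∃ n : ℕ, Nonempty (Retract X (⨁ fun _ : Fin n => T))

/-- `f` belongs to the ideal `(T)` of morphisms that factor through a finite direct sum of
copies of `T`. -/
def InIdeal (T : C) {X Y : C} (f : X ⟶ Y) : Prop :=
  ∃ (n : ℕ) (a : X ⟶ ⨁ fun _ : Fin n => T) (b : (⨁ fun _ : Fin n => T) ⟶ Y), f = a ≫ b

/-- `T` is a cluster-tilting object: `𝒞(T, ΣT) = 0`, and `𝒞(X, ΣT) = 0` implies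
`X ∈ add T`. -/
structure IsClusterTilting [HasShift C ℤ] (T : C) : Prop where
  rigid : ∀ f : T ⟶ T⟦(1 : ℤ)⟧, f = 0
  mem_add : ∀ X : C, (∀ f : X ⟶ T⟦(1 : ℤ)⟧, f = 0) → InAdd T X

end

section

variable {C : Type u} [Category.{v} C] [Preadditive C]

/-- The functor `F = 𝒞(T, ?)` to right modules over `End T`, that is, to modules over
`(End T)ᵐᵒᵖ`, the endomorphisms of `T` acting by precomposition. -/
abbrev F (T : C) : C ⥤ ModuleCat.{v} (End T)ᵐᵒᵖ :=
  preadditiveCoyonedaObj T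

/-- Condition (i) on the sequence `M ⟶ B ⟶ L` (with maps `i`, `p`) and on `iU : U ⟶ M`,
`iV : V ⟶ L`: there is a submodule `E` of `FB` with `FV = (Fp)E` and `FU = (Fi)⁻¹E`, where `FU`
and `FV` are identified with their images in `FM` and `FL`. -/
def CondI (T : C) {M B L U V : C} (i : M ⟶ B) (p : B ⟶ L) (iU : U ⟶ M) (iV : V ⟶ L) : Prop :=
  ∃ E : Submodule (End T)ᵐᵒᵖ ((F T).obj B),
    LinearMap.range ((F T).map iV).hom = E.map ((F T).map p).hom ∧
      LinearMap.range ((F T).map iU).hom = E.comap ((F T).map i).hom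

variable [HasShift C ℤ]

/-- The morphism `Σ⁻¹ε : Σ⁻¹L ⟶ M` obtained from `ε : L ⟶ ΣM`, through the canonical
isomorphism `Σ⁻¹ΣM ≅ M`. -/
def desusp {L M : C} (ε : L ⟶ M⟦(1 : ℤ)⟧) : L⟦(-1 : ℤ)⟧ ⟶ M :=
  ε⟦(-1 : ℤ)⟧' ≫ (shiftShiftNeg M (1 : ℤ)).hom

variable [HasFiniteBiproducts C]

/-- The requirements (a), (b), (c) on a pair of morphisms `e : Σ⁻¹V ⟶ U` and `f : Σ⁻¹L ⟶ U`. -/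
structure IsFactorization (T : C) {M L U V : C} (ε : L ⟶ M⟦(1 : ℤ)⟧) (iU : U ⟶ M) (iV : V ⟶ L)
    (e : V⟦(-1 : ℤ)⟧ ⟶ U) (f : L⟦(-1 : ℤ)⟧ ⟶ U) : Prop where
  comm : iV⟦(-1 : ℤ)⟧' ≫ desusp ε = e ≫ iU
  e_mem : InIdeal T e
  f_mem : InIdeal (T⟦(1 : ℤ)⟧) (f ≫ iU - desusp ε)

/-- Condition (ii). -/
def CondII (T : C) {M L U V : C} (ε : L ⟶ M⟦(1 : ℤ)⟧) (iU : U ⟶ M) (iV : V ⟶ L) : Prop :=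
  ∃ (e : V⟦(-1 : ℤ)⟧ ⟶ U) (f : L⟦(-1 : ℤ)⟧ ⟶ U), IsFactorization T ε iU iV e f

/-- Condition (iii): condition (ii) where, moreover, `e = f ∘ Σ⁻¹iV`. -/
def CondIII (T : C) {M L U V : C} (ε : L ⟶ M⟦(1 : ℤ)⟧) (iU : U ⟶ M) (iV : V ⟶ L) : Prop :=
  ∃ (e : V⟦(-1 : ℤ)⟧ ⟶ U) (f : L⟦(-1 : ℤ)⟧ ⟶ U),
    IsFactorization T ε iU iV e f ∧ e = iV⟦(-1 : ℤ)⟧' ≫ f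

end

end TwoCY

end

/-! Put e and f in suspended form, V → ΣU and L → ΣU. For a cluster-tilting S (both T and ΣT are
used), Σ⁻¹a lies in (S) exactly when 𝒞(S, a) = 0 (`inIdeal_desusp_iff`), so (ii) and (iii) become
vanishing conditions.

For a single triangle, (iii) ⇒ (ii) is clear. Given (ii), the image of F of an extension W of V by U
serves as E. Given (i), e and f come from approximations of V and L, and the 2-Calabi–Yau duality
lets f be corrected until it restricts to e.

The dichotomy is linear duality. Condition (iii) for Δ is a homogeneous linear system in (f, η), to
be solved with η = ε. As 𝒞(L, ΣM) is a line, it has no such solution exactly when pairing with ε'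
kills all solutions, that is, when this functional is a combination of the equations. The
coefficients of such a combination give (ii) for Δ' (`condIII_iff_not_condII`). -/

noncomputable section

namespace TwoCY

/-! ### Lifting and vanishing for objects of `add S` -/

section Add

variable {C : Type u} [Category.{v} C] [Preadditive C] [HasFiniteBiproducts C]

/-- `f` is annihilated by `S`: every composite `S ⟶ X ⟶ Y` with `f` vanishes, that is,
`𝒞(S, f) = 0`. -/
def KilledBy (S : C) {X Y : C} (f : X ⟶ Y) : Prop :=
  ∀ t : S ⟶ X, t ≫ f = 0

lemma inAdd_biproduct (T : C) (n : ℕ) : InAdd T (⨁ fun _ : Fin n => T) :=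
  ⟨n, ⟨Retract.refl _⟩⟩

lemma biproduct_comp_eq_zero {S X Y : C} {n : ℕ} {f : X ⟶ Y} (hf : KilledBy S f)
    (c : (⨁ fun _ : Fin n => S) ⟶ X) : c ≫ f = 0 := by
  refine biproduct.hom_ext' _ _ fun j => ?_
  rw [← Category.assoc, hf, comp_zero]

lemma KilledBy.comp_eq_zero {S P X Y : C} (hP : InAdd S P) {f : X ⟶ Y} (hf : KilledBy S f)
    (c : P ⟶ X) : c ≫ f = 0 := by
  obtain ⟨n, ⟨r⟩⟩ := hP
  have h := biproduct_comp_eq_zero hf (r.r ≫ c)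
  rw [← Category.id_comp c, ← r.retract, Category.assoc, Category.assoc, ← Category.assoc r.r, h,
    comp_zero]

/-- Objects of `add S` have the lifting property that `S` has. -/
lemma exists_lift_of_inAdd {S P X Y : C} (hP : InAdd S P) (j : X ⟶ Y) (s : P ⟶ Y)
    (hs : ∀ c : S ⟶ P, ∃ u : S ⟶ X, u ≫ j = c ≫ s) : ∃ s' : P ⟶ X, s' ≫ j = s := by
  obtain ⟨n, ⟨r⟩⟩ := hP
  choose u hu using fun m : Fin n => hs (biproduct.ι (fun _ : Fin n => S) m ≫ r.r)
  have h : biproduct.desc u ≫ j = r.r ≫ s := by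
    refine biproduct.hom_ext' _ _ fun m => ?_
    rw [biproduct.ι_desc_assoc, hu, Category.assoc]
  exact ⟨r.i ≫ biproduct.desc u, by
    rw [Category.assoc, h, ← Category.assoc, r.retract, Category.id_comp]⟩

lemma inIdeal_of_inAdd {S P X Y : C} (hP : InAdd S P) (a : X ⟶ P) (b : P ⟶ Y) :
    InIdeal S (a ≫ b) := by
  obtain ⟨n, ⟨r⟩⟩ := hP
  refine ⟨n, a ≫ r.i, r.r ≫ b, ?_⟩
  rw [Category.assoc, ← Category.assoc r.i, r.retract, Category.id_comp]

lemma eq_zero_of_comp_eq_zero {S P X Y : C} (hP : InAdd S P) {j : X ⟶ Y}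
    (hj : ∀ u : S ⟶ X, u ≫ j = 0 → u = 0) (s : P ⟶ X) (hs : s ≫ j = 0) : s = 0 := by
  have h : KilledBy S s := fun c => hj _ (by rw [Category.assoc, hs, comp_zero])
  rw [← Category.id_comp s]
  exact h.comp_eq_zero hP (𝟙 P)

lemma InAdd.of_iso {S S' P P' : C} (hP : InAdd S P) (e : S ≅ S') (e' : P ≅ P') :
    InAdd S' P' := by
  obtain ⟨m, ⟨r⟩⟩ := hP
  exact ⟨m, ⟨(Retract.ofIso e'.symm).trans
    (r.trans (Retract.ofIso (biproduct.mapIso fun _ => e)))⟩⟩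

variable [HasShift C ℤ] [∀ n : ℤ, (shiftFunctor C n).Additive]

lemma InAdd.shift {S P : C} (hP : InAdd S P) (n : ℤ) : InAdd (S⟦n⟧) (P⟦n⟧) := by
  obtain ⟨m, ⟨r⟩⟩ := hP
  exact ⟨m, ⟨(r.map (shiftFunctor C n)).trans
    (Retract.ofIso ((shiftFunctor C n).mapBiproduct fun _ : Fin m => S))⟩⟩

/-- If `𝒞(S, ΣS) = 0`, then `𝒞(S, ΣP) = 0` for all `P` in `add S`. -/
lemma eq_zero_of_rigid {S P : C} (hS : ∀ f : S ⟶ S⟦(1 : ℤ)⟧, f = 0) (hP : InAdd S P)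
    (f : S ⟶ P⟦(1 : ℤ)⟧) : f = 0 := by
  obtain ⟨n, ⟨r⟩⟩ := hP.shift 1
  have h : f ≫ r.i = 0 := biproduct.hom_ext _ _ fun j => by
    rw [Category.assoc, hS (f ≫ r.i ≫ _), zero_comp]
  rw [← Category.comp_id f, ← r.retract, ← Category.assoc, h, zero_comp]

end Add

/-! ### Conditions on submodules in terms of morphisms from T -/

section Modules

variable {C : Type u} [Category.{v} C] [Preadditive C]

lemma condI_iff {T M B L U V : C} (i : M ⟶ B) (p : B ⟶ L) (iU : U ⟶ M) (iV : V ⟶ L) :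
    CondI T i p iU iV ↔ ∃ E : Submodule (End T)ᵐᵒᵖ ((F T).obj B),
      (∀ l : T ⟶ L, (∃ v : T ⟶ V, v ≫ iV = l) ↔ ∃ b : T ⟶ B, b ∈ E ∧ b ≫ p = l) ∧
      ∀ m : T ⟶ M, (∃ u : T ⟶ U, u ≫ iU = m) ↔ m ≫ i ∈ E := by
  refine exists_congr fun E => and_congr ?_ ?_ <;> rw [SetLike.ext_iff] <;> rfl

lemma eq_zero_of_mono_map {T U M : C} {iU : U ⟶ M} (h : Mono ((F T).map iU)) (u : T ⟶ U)
    (hu : u ≫ iU = 0) : u = 0 :=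
  (ModuleCat.mono_iff_injective _).1 h (hu.trans zero_comp.symm)

lemma shift_comp_eq_zero [HasShift C ℤ] [∀ n : ℤ, (shiftFunctor C n).Additive]
    {T U M : C} {iU : U ⟶ M} (h : ∀ u : T ⟶ U, u ≫ iU = 0 → u = 0)
    (u : T⟦(1 : ℤ)⟧ ⟶ U⟦(1 : ℤ)⟧) (hu : u ≫ iU⟦(1 : ℤ)⟧' = 0) : u = 0 := by
  obtain ⟨u, rfl⟩ := (shiftFunctor C (1 : ℤ)).map_surjective u
  rw [← Functor.map_comp] at hu
  rw [h u ((shiftFunctor C (1 : ℤ)).map_injective (by rw [hu, Functor.map_zero])),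
    Functor.map_zero]

end Modules

/-! ### Desuspension of morphisms -/

section Desusp

variable {C : Type u} [Category.{v} C] [HasShift C ℤ]

lemma desusp_injective {L M : C} : Function.Injective (desusp (L := L) (M := M)) := by
  intro a b h
  exact (shiftFunctor C (-1 : ℤ)).map_injective ((cancel_mono _).1 h)

lemma desusp_surjective {L M : C} : Function.Surjective (desusp (L := L) (M := M)) := by
  intro e
  refine ⟨(shiftFunctor C (-1 : ℤ)).preimage (e ≫ (shiftShiftNeg M (1 : ℤ)).inv), ?_⟩
  unfold desusp
  rw [Functor.map_preimage]
  exact (Category.assoc _ _ _).trans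
    ((congrArg (e ≫ ·) (shiftShiftNeg M (1 : ℤ)).inv_hom_id).trans (Category.comp_id e))

lemma desusp_precomp {V L M : C} (j : V ⟶ L) (a : L ⟶ M⟦(1 : ℤ)⟧) :
    desusp (j ≫ a) = j⟦(-1 : ℤ)⟧' ≫ desusp a := by
  unfold desusp
  rw [Functor.map_comp]
  exact Category.assoc _ _ _

lemma desusp_postcomp {L U M : C} (a : L ⟶ U⟦(1 : ℤ)⟧) (j : U ⟶ M) :
    desusp (a ≫ j⟦(1 : ℤ)⟧') = desusp a ≫ j := by
  unfold desusp
  rw [Functor.map_comp]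
  exact (Category.assoc _ _ _).trans ((congrArg (a⟦(-1 : ℤ)⟧' ≫ ·)
    ((shiftFunctorCompIsoId C (1 : ℤ) (-1) (by simp)).hom.naturality j)).trans
      (Category.assoc _ _ _).symm)

variable [Preadditive C]

lemma desusp_sub [∀ n : ℤ, (shiftFunctor C n).Additive] {L M : C} (a b : L ⟶ M⟦(1 : ℤ)⟧) :
    desusp (a - b) = desusp a - desusp b := by
  unfold desusp
  rw [Functor.map_sub]
  exact Preadditive.sub_comp _ _ _

lemma desusp_zero [∀ n : ℤ, (shiftFunctor C n).Additive] {L M : C} :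
    desusp (0 : L ⟶ M⟦(1 : ℤ)⟧) = 0 := by
  rw [← sub_self 0, desusp_sub, sub_self]

end Desusp

/-! ### Approximations, the ideals (T) and (ΣT), and (ii) ⇒ (i) -/

section ClusterTilting

variable {C : Type u} [Category.{v} C] [Preadditive C] [HasZeroObject C]
  [HasShift C ℤ] [∀ n : ℤ, (shiftFunctor C n).Additive] [Pretriangulated C]

section Exactness

variable {X Y Z : C} {f : X ⟶ Y} {g : Y ⟶ Z} {h : Z ⟶ X⟦(1 : ℤ)⟧}

lemma exists_eq_comp_mor₁ (hΔ : Triangle.mk f g h ∈ distTriang C)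
    {A : C} (a : A ⟶ Y) (ha : a ≫ g = 0) : ∃ b : A ⟶ X, a = b ≫ f :=
  Triangle.coyoneda_exact₂ _ hΔ a ha

lemma exists_eq_comp_mor₂ (hΔ : Triangle.mk f g h ∈ distTriang C)
    {A : C} (a : A ⟶ Z) (ha : a ≫ h = 0) : ∃ b : A ⟶ Y, a = b ≫ g :=
  Triangle.coyoneda_exact₃ _ hΔ a ha

lemma exists_eq_comp_mor₃ (hΔ : Triangle.mk f g h ∈ distTriang C)
    {A : C} (a : A ⟶ X⟦(1 : ℤ)⟧) (ha : a ≫ f⟦(1 : ℤ)⟧' = 0) :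
    ∃ b : A ⟶ Z, a = b ≫ h :=
  Triangle.coyoneda_exact₁ _ hΔ a ha

lemma exists_eq_mor₂_comp (hΔ : Triangle.mk f g h ∈ distTriang C)
    {A : C} (a : Y ⟶ A) (ha : f ≫ a = 0) : ∃ b : Z ⟶ A, a = g ≫ b :=
  Triangle.yoneda_exact₂ _ hΔ a ha

lemma exists_eq_mor₃_comp (hΔ : Triangle.mk f g h ∈ distTriang C)
    {A : C} (a : Z ⟶ A) (ha : g ≫ a = 0) :
    ∃ b : X⟦(1 : ℤ)⟧ ⟶ A, a = h ≫ b :=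
  Triangle.yoneda_exact₃ _ hΔ a ha

variable {X' Y' Z' : C} {f' : X' ⟶ Y'} {g' : Y' ⟶ Z'} {h' : Z' ⟶ X'⟦(1 : ℤ)⟧}

lemma exists_hom₁ (hΔ : Triangle.mk f g h ∈ distTriang C)
    (hΔ' : Triangle.mk f' g' h' ∈ distTriang C)
    (b : Y ⟶ Y') (c : Z ⟶ Z') (comm : g ≫ c = b ≫ g') :
    ∃ a : X ⟶ X', f ≫ b = a ≫ f' ∧ h ≫ a⟦(1 : ℤ)⟧' = c ≫ h' :=
  complete_distinguished_triangle_morphism₁ _ _ hΔ hΔ' b c comm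

lemma exists_hom₂ (hΔ : Triangle.mk f g h ∈ distTriang C)
    (hΔ' : Triangle.mk f' g' h' ∈ distTriang C)
    (a : X ⟶ X') (c : Z ⟶ Z') (comm : h ≫ a⟦(1 : ℤ)⟧' = c ≫ h') :
    ∃ b : Y ⟶ Y', f ≫ b = a ≫ f' ∧ g ≫ c = b ≫ g' :=
  complete_distinguished_triangle_morphism₂ _ _ hΔ hΔ' a c comm

end Exactness

lemma IsClusterTilting.shift {T : C} (hT : IsClusterTilting T) :
    IsClusterTilting (T⟦(1 : ℤ)⟧) where
  rigid f := by
    obtain ⟨g, rfl⟩ := (shiftFunctor C (1 : ℤ)).map_surjective f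
    rw [hT.rigid g, Functor.map_zero]
  mem_add X hX := by
    have h := hT.mem_add (X⟦(-1 : ℤ)⟧) fun f => by
      obtain ⟨a, rfl⟩ := desusp_surjective f
      rw [hX a, desusp_zero]
    exact (h.shift 1).of_iso (Iso.refl _) (shiftNegShift X (1 : ℤ))

/-- Every object `X` has an `add S`-presentation, a triangle `P ⟶ Sⁿ ⟶ X ⟶ ΣP` with `P` in
`add S` and `Sⁿ ⟶ X` a right `add S`-approximation. -/
def HasPresentations (S : C) : Prop :=
  ∀ X : C, ∃ (P : C) (n : ℕ) (κ : P ⟶ ⨁ fun _ : Fin n => S) (π : (⨁ fun _ : Fin n => S) ⟶ X)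
    (w : X ⟶ P⟦(1 : ℤ)⟧), Triangle.mk κ π w ∈ distTriang C ∧ InAdd S P ∧ KilledBy S w

/-- A basis of the finite-dimensional space 𝒞(S, X) gives a right approximation π. Rigidity makes
every map S → ΣP factor through w, which S annihilates; hence 𝒞(S, ΣP) = 0, and duality turns this
into 𝒞(P, ΣS) = 0. -/
lemma IsClusterTilting.hasPresentations {k : Type w} [Field k] [Linear k C]
    (hfin : ∀ X Y : C, Module.Finite k (X ⟶ Y)) (hCY : IsTwoCalabiYau k C)
    {S : C} (hS : IsClusterTilting S) : HasPresentations S := by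
  intro X
  have := hfin S X
  let b := Module.finBasis k (S ⟶ X)
  let π : (⨁ fun _ : Fin (Module.finrank k (S ⟶ X)) => S) ⟶ X := biproduct.desc fun j => b j
  have hπ : ∀ t : S ⟶ X, ∃ c, t = c ≫ π := fun t => by
    refine ⟨∑ j, b.repr t j • biproduct.ι (fun _ => S) j, ?_⟩
    conv_lhs => rw [← b.sum_repr t]
    simp [Preadditive.sum_comp, π]
  obtain ⟨P, κ, w, hw⟩ := distinguished_cocone_triangle₁ π
  have hkill : KilledBy S w := fun t => by
    obtain ⟨c, rfl⟩ := hπ t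
    have : π ≫ w = 0 := comp_distTriang_mor_zero₂₃ _ hw
    rw [Category.assoc, this, comp_zero]
  refine ⟨P, _, κ, π, w, hw, hS.mem_add P ?_, hkill⟩
  obtain ⟨φ, -⟩ := hCY
  have hzero : ∀ g : S ⟶ P⟦(1 : ℤ)⟧, g = 0 := fun g => by
    obtain ⟨c, hc⟩ := exists_eq_comp_mor₃ hw g
      (eq_zero_of_rigid hS.rigid (inAdd_biproduct S _) _)
    exact hc.trans (hkill c)
  intro f
  refine (φ P S).injective ?_
  rw [map_zero]
  ext g
  rw [hzero g, map_zero, map_zero]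

/-- Such an a vanishes on the approximation Sⁿ → X, so it factors through the connecting morphism of
the presentation. -/
lemma KilledBy.exists_factorization {S : C} (hS : HasPresentations S) {X Y : C}
    {a : X ⟶ Y⟦(1 : ℤ)⟧} (ha : KilledBy S a) :
    ∃ (P : C) (w : X ⟶ P⟦(1 : ℤ)⟧) (c : P ⟶ Y), InAdd S P ∧ a = w ≫ c⟦(1 : ℤ)⟧' := by
  obtain ⟨P, n, κ, π, w, hw, hP, -⟩ := hS X
  obtain ⟨g, hg⟩ := exists_eq_mor₃_comp hw a (biproduct_comp_eq_zero ha π)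
  obtain ⟨c, rfl⟩ := (shiftFunctor C (1 : ℤ)).map_surjective g
  exact ⟨P, w, c, hP, hg⟩

/-- A morphism `Σ⁻¹X ⟶ Y` belongs to the ideal `(S)` if and only if the corresponding morphism
`X ⟶ ΣY` is annihilated by `S`. -/
lemma inIdeal_desusp_iff {S : C} (hS : IsClusterTilting S) (hS' : HasPresentations S)
    {X Y : C} (a : X ⟶ Y⟦(1 : ℤ)⟧) : InIdeal S (desusp a) ↔ KilledBy S a := by
  constructor
  · rintro ⟨n, b, c, h⟩ t
    obtain ⟨b, rfl⟩ := desusp_surjective b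
    rw [← desusp_postcomp] at h
    rw [desusp_injective h, ← Category.assoc,
      eq_zero_of_rigid hS.rigid (inAdd_biproduct S n) (t ≫ b), zero_comp]
  · intro h
    obtain ⟨P, w, c, hP, rfl⟩ := h.exists_factorization hS'
    rw [desusp_postcomp]
    exact inIdeal_of_inAdd hP _ _

/-- The requirements on `e` and `f`, formulated for `Σe` and `Σf`. -/
lemma isFactorization_desusp_iff {T : C} (hT : IsClusterTilting T) (hp : HasPresentations T)
    (hp' : HasPresentations (T⟦(1 : ℤ)⟧)) {M L U V : C} (ε : L ⟶ M⟦(1 : ℤ)⟧) (iU : U ⟶ M)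
    (iV : V ⟶ L) (e : V ⟶ U⟦(1 : ℤ)⟧) (f : L ⟶ U⟦(1 : ℤ)⟧) :
    IsFactorization T ε iU iV (desusp e) (desusp f) ↔
      iV ≫ ε = e ≫ iU⟦(1 : ℤ)⟧' ∧ KilledBy T e ∧
        KilledBy (T⟦(1 : ℤ)⟧) (f ≫ iU⟦(1 : ℤ)⟧' - ε) := by
  rw [← inIdeal_desusp_iff hT hp, ← inIdeal_desusp_iff hT.shift hp', desusp_sub, desusp_postcomp,
    ← desusp_injective.eq_iff, desusp_precomp, desusp_postcomp]
  exact ⟨fun h => ⟨h.comm, h.e_mem, h.f_mem⟩, fun h => ⟨h.1, h.2.1, h.2.2⟩⟩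

lemma condII_iff {T : C} (hT : IsClusterTilting T) (hp : HasPresentations T)
    (hp' : HasPresentations (T⟦(1 : ℤ)⟧)) {M L U V : C} (ε : L ⟶ M⟦(1 : ℤ)⟧) (iU : U ⟶ M)
    (iV : V ⟶ L) :
    CondII T ε iU iV ↔ ∃ (e : V ⟶ U⟦(1 : ℤ)⟧) (f : L ⟶ U⟦(1 : ℤ)⟧),
      iV ≫ ε = e ≫ iU⟦(1 : ℤ)⟧' ∧ KilledBy T e ∧
        KilledBy (T⟦(1 : ℤ)⟧) (f ≫ iU⟦(1 : ℤ)⟧' - ε) := by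
  simp only [CondII, desusp_surjective.exists, isFactorization_desusp_iff hT hp hp']

lemma condIII_iff {T : C} (hT : IsClusterTilting T) (hp : HasPresentations T)
    (hp' : HasPresentations (T⟦(1 : ℤ)⟧)) {M L U V : C} (ε : L ⟶ M⟦(1 : ℤ)⟧) (iU : U ⟶ M)
    (iV : V ⟶ L) :
    CondIII T ε iU iV ↔ ∃ f : L ⟶ U⟦(1 : ℤ)⟧,
      iV ≫ ε = (iV ≫ f) ≫ iU⟦(1 : ℤ)⟧' ∧ KilledBy T (iV ≫ f) ∧
        KilledBy (T⟦(1 : ℤ)⟧) (f ≫ iU⟦(1 : ℤ)⟧' - ε) := by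
  simp only [CondIII, desusp_surjective.exists, isFactorization_desusp_iff hT hp hp',
    ← desusp_precomp, desusp_injective.eq_iff]
  constructor
  · rintro ⟨e, f, h, rfl⟩
    exact ⟨f, h⟩
  · rintro ⟨f, h⟩
    exact ⟨_, f, h, rfl⟩

lemma condI_of_condII {T : C} (hT : IsClusterTilting T) (hp : HasPresentations T)
    (hp' : HasPresentations (T⟦(1 : ℤ)⟧)) {M B L U V : C} {i : M ⟶ B} {p : B ⟶ L}
    {ε : L ⟶ M⟦(1 : ℤ)⟧} (hΔ : Triangle.mk i p ε ∈ distTriang C) {iU : U ⟶ M} {iV : V ⟶ L}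
    (hV : Mono ((F T).map iV)) (h : CondII T ε iU iV) : CondI T i p iU iV := by
  obtain ⟨e, f, hcomm, he, hf⟩ := (condII_iff hT hp hp' ε iU iV).1 h
  -- W is the extension of V by U with class e; (a) yields a map W → B compatible with the two
  -- triangles, and (b) makes FW → FV surjective.
  obtain ⟨W, j, q, hW⟩ := distinguished_cocone_triangle₂ e
  obtain ⟨iW, hjW, hqW⟩ := exists_hom₂ hW hΔ iU iV hcomm.symm
  have hip : i ≫ p = 0 := comp_distTriang_mor_zero₁₂ _ hΔ
  refine (condI_iff i p iU iV).2 ⟨LinearMap.range ((F T).map iW).hom, fun l => ?_, fun m => ?_⟩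
  · constructor
    · rintro ⟨v, rfl⟩
      obtain ⟨x, rfl⟩ := exists_eq_comp_mor₂ hW v (he v)
      exact ⟨x ≫ iW, ⟨x, rfl⟩, by simp [hqW]⟩
    · rintro ⟨b, hb, rfl⟩
      obtain ⟨x, rfl⟩ : ∃ x : T ⟶ W, x ≫ iW = b := hb
      exact ⟨x ≫ q, by simp [hqW]⟩
  · constructor
    · rintro ⟨u, rfl⟩
      refine ⟨u ≫ j, ?_⟩
      change (u ≫ j) ≫ iW = (u ≫ iU) ≫ i
      simp [hjW]
    · intro hm
      obtain ⟨x, hx⟩ : ∃ x : T ⟶ W, x ≫ iW = m ≫ i := hm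
      have hxq : x ≫ q = 0 := eq_zero_of_mono_map hV _ (by
        rw [Category.assoc, hqW, ← Category.assoc, hx, Category.assoc, hip, comp_zero])
      obtain ⟨u, rfl⟩ := exists_eq_comp_mor₁ hW x hxq
      have hd : (m - u ≫ iU) ≫ i = 0 := by
        rw [Preadditive.sub_comp, ← hx, Category.assoc, Category.assoc, hjW, sub_self]
      -- The difference lies in the kernel of Fi, so its suspension factors through ε. By (c), ε may
      -- be replaced there by f followed by ΣiU, which puts the difference in FU.
      obtain ⟨t, ht⟩ := exists_eq_comp_mor₃ hΔ ((m - u ≫ iU)⟦(1 : ℤ)⟧') (by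
        rw [← Functor.map_comp, hd, Functor.map_zero])
      have h' := hf t
      rw [Preadditive.comp_sub, ← ht, sub_eq_zero, ← Category.assoc] at h'
      obtain ⟨u', hu'⟩ := (shiftFunctor C (1 : ℤ)).map_surjective (t ≫ f)
      rw [← hu', ← Functor.map_comp] at h'
      have h'' := (shiftFunctor C (1 : ℤ)).map_injective h'
      exact ⟨u' + u, by rw [Preadditive.add_comp, h'', sub_add_cancel]⟩

end ClusterTilting

/-! ### The Calabi–Yau pairing -/

section Pairing

variable {k : Type w} [Field k] {C : Type u} [Category.{v} C] [Preadditive C] [Linear k C]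
  [HasShift C ℤ]

/-- The isomorphisms `φ X Y : 𝒞(X, ΣY) ≃ D 𝒞(Y, ΣX)` are natural in `X` and `Y`. -/
def IsNaturalPairing
    (φ : ∀ X Y : C, (X ⟶ Y⟦(1 : ℤ)⟧) ≃ₗ[k] Module.Dual k (Y ⟶ X⟦(1 : ℤ)⟧)) : Prop :=
  ∀ (X X' Y Y' : C) (f : X' ⟶ X) (g : Y ⟶ Y') (a : X ⟶ Y⟦(1 : ℤ)⟧) (b : Y' ⟶ X'⟦(1 : ℤ)⟧),
    φ X' Y' (f ≫ a ≫ g⟦(1 : ℤ)⟧') b = φ X Y a (g ≫ b ≫ f⟦(1 : ℤ)⟧')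

variable {φ : ∀ X Y : C, (X ⟶ Y⟦(1 : ℤ)⟧) ≃ₗ[k] Module.Dual k (Y ⟶ X⟦(1 : ℤ)⟧)}

lemma pairing_precomp
    (hφ : IsNaturalPairing φ)
    {X X' Y : C} (f : X' ⟶ X) (a : X ⟶ Y⟦(1 : ℤ)⟧) (b : Y ⟶ X'⟦(1 : ℤ)⟧) :
    φ X' Y (f ≫ a) b = φ X Y a (b ≫ f⟦(1 : ℤ)⟧') := by
  have h := hφ X X' Y Y f (𝟙 Y) a b
  rwa [(shiftFunctor C (1 : ℤ)).map_id, Category.comp_id, Category.id_comp] at h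

lemma pairing_postcomp
    (hφ : IsNaturalPairing φ)
    {X Y Y' : C} (g : Y ⟶ Y') (a : X ⟶ Y⟦(1 : ℤ)⟧) (b : Y' ⟶ X⟦(1 : ℤ)⟧) :
    φ X Y' (a ≫ g⟦(1 : ℤ)⟧') b = φ X Y a (g ≫ b) := by
  have h := hφ X X Y Y' (𝟙 X) g a b
  rwa [(shiftFunctor C (1 : ℤ)).map_id, Category.comp_id, Category.id_comp] at h

/-- If `𝒞(Q, Σj)` is injective, then `𝒞(j, ΣQ)` is surjective. -/
lemma exists_extension (hCY : IsTwoCalabiYau k C) {Q V L : C} (j : V ⟶ L)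
    (hj : ∀ y : Q ⟶ V⟦(1 : ℤ)⟧, y ≫ j⟦(1 : ℤ)⟧' = 0 → y = 0) (a : V ⟶ Q⟦(1 : ℤ)⟧) :
    ∃ b : L ⟶ Q⟦(1 : ℤ)⟧, j ≫ b = a := by
  obtain ⟨φ, hφ⟩ := hCY
  suffices h : Function.Surjective (Linear.leftComp k (Q⟦(1 : ℤ)⟧) j) from h a
  -- Under φ, the transpose of precomposition with j is postcomposition with Σj.
  rw [← LinearMap.dualMap_injective_iff, injective_iff_map_eq_zero]
  intro μ hμ
  obtain ⟨y, rfl⟩ := (φ Q V).surjective μ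
  rw [hj y, map_zero]
  refine (φ Q L).injective ?_
  rw [map_zero]
  ext b
  rw [pairing_postcomp hφ]
  exact LinearMap.congr_fun hμ b

/-- The morphisms annihilated by `S`, as a subspace of `𝒞(X, Y)`. -/
def killed (k : Type w) [Field k] [Linear k C] (S X Y : C) : Submodule k (X ⟶ Y) where
  carrier := {f | KilledBy S f}
  add_mem' ha hb t := by rw [Preadditive.comp_add, ha t, hb t, add_zero]
  zero_mem' _ := comp_zero
  smul_mem' c f hf t := by rw [Linear.comp_smul, hf t, smul_zero]

end Pairing

/-! ### (i) ⇒ (iii), and the dichotomy between Δ and Δ' -/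

section Duality

variable {k : Type w} [Field k] {C : Type u} [Category.{v} C] [Preadditive C] [Linear k C]
  [HasZeroObject C] [HasShift C ℤ] [∀ n : ℤ, (shiftFunctor C n).Additive] [Pretriangulated C]
  {φ : ∀ X Y : C, (X ⟶ Y⟦(1 : ℤ)⟧) ≃ₗ[k] Module.Dual k (Y ⟶ X⟦(1 : ℤ)⟧)}

lemma condIII_of_condI (hCY : IsTwoCalabiYau k C) {T : C} (hT : IsClusterTilting T)
    (hp : HasPresentations T) (hp' : HasPresentations (T⟦(1 : ℤ)⟧)) {M B L U V : C} {i : M ⟶ B}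
    {p : B ⟶ L} {ε : L ⟶ M⟦(1 : ℤ)⟧} (hΔ : Triangle.mk i p ε ∈ distTriang C) {iU : U ⟶ M}
    {iV : V ⟶ L} (hU : Mono ((F T).map iU)) (hV : Mono ((F T).map iV))
    (h : CondI T i p iU iV) : CondIII T ε iU iV := by
  obtain ⟨E, hEV, hEU⟩ := (condI_iff i p iU iV).1 h
  have hU' := shift_comp_eq_zero (eq_zero_of_mono_map hU)
  have hV' := shift_comp_eq_zero (eq_zero_of_mono_map hV)
  have hεi : ε ≫ i⟦(1 : ℤ)⟧' = 0 := comp_distTriang_mor_zero₃₁ _ hΔ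
  -- Lift an approximation Tⁿ → V to B with components in E; the induced map P → M then lands in FU
  -- and lifts to U.
  obtain ⟨e, hcomm, he⟩ : ∃ e : V ⟶ U⟦(1 : ℤ)⟧, iV ≫ ε = e ≫ iU⟦(1 : ℤ)⟧' ∧ KilledBy T e := by
    obtain ⟨P, n, κ, π, w, hw, hP, hkill⟩ := hp V
    choose b hbE hb using fun m : Fin n =>
      (hEV _).1 ⟨biproduct.ι (fun _ : Fin n => T) m ≫ π, rfl⟩
    have hdesc : π ≫ iV = biproduct.desc b ≫ p := by
      refine biproduct.hom_ext' _ _ fun m => ?_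
      rw [biproduct.ι_desc_assoc, hb, Category.assoc]
    have hmem : ∀ c : T ⟶ ⨁ fun _ : Fin n => T, c ≫ biproduct.desc b ∈ E := fun c => by
      have : c ≫ biproduct.desc b = ∑ m, (c ≫ biproduct.π (fun _ : Fin n => T) m) ≫ b m := by
        rw [biproduct.desc_eq, Preadditive.comp_sum]
        simp
      rw [this]
      exact E.sum_mem fun m _ =>
        E.smul_mem (MulOpposite.op (c ≫ biproduct.π (fun _ : Fin n => T) m)) (hbE m)
    obtain ⟨s, hs, hsw⟩ := exists_hom₁ hw hΔ _ iV hdesc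
    obtain ⟨s', rfl⟩ := exists_lift_of_inAdd hP iU s fun c => (hEU _).2 (by
      rw [Category.assoc, ← hs, ← Category.assoc]
      exact hmem _)
    refine ⟨w ≫ s'⟦(1 : ℤ)⟧', ?_, fun t => ?_⟩
    · rw [← hsw, Functor.map_comp, Category.assoc]
    · rw [← Category.assoc, hkill, zero_comp]
  -- FU contains the kernel of Fi, so ε lifts through ΣiU on a ΣT-approximation of L; injectivity of
  -- FiU lets the lift descend to L.
  obtain ⟨f, hf⟩ : ∃ f : L ⟶ U⟦(1 : ℤ)⟧, KilledBy (T⟦(1 : ℤ)⟧) (f ≫ iU⟦(1 : ℤ)⟧' - ε) := by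
    obtain ⟨P, n, κ, π, w, hw, hP, hkill⟩ := hp' L
    obtain ⟨g, hg⟩ := exists_lift_of_inAdd (inAdd_biproduct _ n) (iU⟦(1 : ℤ)⟧') (π ≫ ε)
      fun c => by
        obtain ⟨m, hm⟩ := (shiftFunctor C (1 : ℤ)).map_surjective (c ≫ π ≫ ε)
        obtain ⟨u, rfl⟩ := (hEU m).2 (by
          have : m ≫ i = 0 := (shiftFunctor C (1 : ℤ)).map_injective (by
            rw [Functor.map_comp, hm, Category.assoc, Category.assoc, hεi, comp_zero, comp_zero,
              Functor.map_zero])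
          rw [this]
          exact E.zero_mem)
        exact ⟨u⟦(1 : ℤ)⟧', by rw [← hm, Functor.map_comp]⟩
    have hκπ : κ ≫ π = 0 := comp_distTriang_mor_zero₁₂ _ hw
    obtain ⟨f, rfl⟩ := exists_eq_mor₂_comp hw g (eq_zero_of_comp_eq_zero hP hU' _ (by
      rw [Category.assoc, hg, ← Category.assoc, hκπ, zero_comp]))
    refine ⟨f, fun t => ?_⟩
    obtain ⟨c, rfl⟩ := exists_eq_comp_mor₂ hw t (hkill t)
    rw [Category.assoc, Preadditive.comp_sub, ← Category.assoc π, hg, sub_self, comp_zero]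
  have hh : KilledBy (T⟦(1 : ℤ)⟧) (iV ≫ f - e) := fun t => hU' _ (by
    have := hf (t ≫ iV)
    simp only [Preadditive.comp_sub, Category.assoc, Preadditive.sub_comp, hcomm] at this ⊢
    exact this)
  -- The defect of e = iV ≫ f factors through ΣQ with Q in add ΣT. Extending w along iV lets it be
  -- subtracted from f; (c) survives because 𝒞(ΣT, ΣQ) = 0.
  obtain ⟨Q, w, c, hQ, hw⟩ := hh.exists_factorization hp'
  obtain ⟨w', rfl⟩ := exists_extension hCY iV
    (fun y hy => eq_zero_of_comp_eq_zero hQ hV' y hy) w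
  have hfe : iV ≫ (f - w' ≫ c⟦(1 : ℤ)⟧') = e := by
    rw [Preadditive.comp_sub, ← Category.assoc, ← hw, sub_sub_cancel]
  refine (condIII_iff hT hp hp' ε iU iV).2 ⟨f - w' ≫ c⟦(1 : ℤ)⟧', ?_, ?_, fun t => ?_⟩
  · rw [hfe, hcomm]
  · rwa [hfe]
  · have h1 := hf t
    have h2 : t ≫ w' = 0 := eq_zero_of_rigid hT.shift.rigid hQ _
    rw [Preadditive.sub_comp, sub_right_comm, Preadditive.comp_sub, h1]
    rw [Category.assoc, ← Category.assoc, h2, zero_comp, sub_zero]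

lemma condI_condII_condIII_tfae (hCY : IsTwoCalabiYau k C) {T : C} (hT : IsClusterTilting T)
    (hp : HasPresentations T) (hp' : HasPresentations (T⟦(1 : ℤ)⟧)) {M B L U V : C} {i : M ⟶ B}
    {p : B ⟶ L} {ε : L ⟶ M⟦(1 : ℤ)⟧} (hΔ : Triangle.mk i p ε ∈ distTriang C) {iU : U ⟶ M}
    {iV : V ⟶ L} (hU : Mono ((F T).map iU)) (hV : Mono ((F T).map iV)) :
    List.TFAE [CondI T i p iU iV, CondII T ε iU iV, CondIII T ε iU iV] := by
  tfae_have 1 → 3 := condIII_of_condI hCY hT hp hp' hΔ hU hV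
  tfae_have 3 → 2 := fun ⟨e, f, h, _⟩ => ⟨e, f, h⟩
  tfae_have 2 → 1 := condI_of_condII hT hp hp' hΔ hV
  tfae_finish

/-- The subspaces of morphisms annihilated by a cluster-tilting object are orthogonal to each
other. -/
lemma pairing_eq_zero
    (hφ : IsNaturalPairing φ)
    {S : C} (hS : HasPresentations S) {X Y : C} {a : X ⟶ Y⟦(1 : ℤ)⟧} {b : Y ⟶ X⟦(1 : ℤ)⟧}
    (ha : KilledBy S a) (hb : KilledBy S b) : φ X Y a b = 0 := by
  obtain ⟨P, w, c, hP, rfl⟩ := hb.exists_factorization hS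
  rw [← pairing_precomp hφ, ha.comp_eq_zero hP, map_zero, LinearMap.zero_apply]

/-- A morphism orthogonal to all morphisms annihilated by a rigid object is itself annihilated by
it. -/
lemma killedBy_of_pairing_eq_zero
    (hφ : IsNaturalPairing φ)
    {S : C} (hS : IsClusterTilting S) {X Y : C} {a : X ⟶ Y⟦(1 : ℤ)⟧}
    (h : ∀ b : Y ⟶ X⟦(1 : ℤ)⟧, KilledBy S b → φ X Y a b = 0) : KilledBy S a := by
  intro t
  refine (φ S Y).injective ?_
  rw [map_zero]
  ext b
  rw [pairing_precomp hφ]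
  -- By rigidity, S annihilates whatever factors through ΣS.
  exact h _ fun c => by rw [← Category.assoc, hS.rigid (c ≫ b), zero_comp]

/-- If both held, ε and ε' would pair to zero by orthogonality of annihilated morphisms, which is
impossible since ε spans 𝒞(L, ΣM). The converse is a Fredholm alternative. -/
lemma condIII_iff_not_condII (hCY : IsTwoCalabiYau k C) {T : C} (hT : IsClusterTilting T)
    (hp : HasPresentations T) (hp' : HasPresentations (T⟦(1 : ℤ)⟧)) {L M U V : C}
    (hdim : Module.finrank k (L ⟶ M⟦(1 : ℤ)⟧) = 1) {ε : L ⟶ M⟦(1 : ℤ)⟧} (hε : ε ≠ 0)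
    {ε' : M ⟶ L⟦(1 : ℤ)⟧} (hε' : ε' ≠ 0) (iU : U ⟶ M) (iV : V ⟶ L) :
    CondIII T ε iU iV ↔ ¬ CondII T ε' iV iU := by
  rw [condIII_iff hT hp hp', condII_iff hT hp hp']
  obtain ⟨φ, hφ⟩ := hCY
  have hgen := (finrank_eq_one_iff_of_nonzero' ε hε).1 hdim
  constructor
  · rintro ⟨f, hcomm, hf, hfz⟩ ⟨y, x, hcomm', hy, hxz⟩
    have h0 : φ M L ε' ε ≠ 0 := fun h => hε' ((φ M L).injective (by
      rw [map_zero]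
      ext η
      obtain ⟨c, rfl⟩ := hgen η
      rw [map_smul, h, smul_zero, LinearMap.zero_apply]))
    set z := f ≫ iU⟦(1 : ℤ)⟧' - ε with hz
    set z' := x ≫ iV⟦(1 : ℤ)⟧' - ε' with hz'
    have hivz : iV ≫ z = 0 := by
      rw [hz, Preadditive.comp_sub, hcomm, Category.assoc, sub_self]
    have h1 : φ M L ε' (f ≫ iU⟦(1 : ℤ)⟧') = 0 := by
      rw [← pairing_precomp hφ, hcomm', pairing_postcomp hφ]
      exact pairing_eq_zero hφ hp hy hf
    have h2 : φ M L ε' z = 0 := by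
      have : φ M L ε' = φ M L (x ≫ iV⟦(1 : ℤ)⟧') - φ M L z' := by
        rw [← map_sub, hz', sub_sub_cancel]
      rw [this, LinearMap.sub_apply, pairing_postcomp hφ, hivz, map_zero,
        pairing_eq_zero hφ hp' hxz hfz, sub_zero]
    refine h0 ?_
    have : ε = f ≫ iU⟦(1 : ℤ)⟧' - z := by rw [hz, sub_sub_cancel]
    rw [this, map_sub, h1, h2, sub_zero]
  · contrapose!
    intro hno
    -- The kernel of β consists of the (f, η) for which f satisfies (iii) with η in place of ε.
    -- Rescaling a solution with η ≠ 0 would give one for ε, so here η = 0 throughout.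
    let A := (L ⟶ U⟦(1 : ℤ)⟧) × (L ⟶ M⟦(1 : ℤ)⟧)
    let δ : A →ₗ[k] (L ⟶ M⟦(1 : ℤ)⟧) :=
      (Linear.rightComp k L (iU⟦(1 : ℤ)⟧')).comp (LinearMap.fst k _ _) - LinearMap.snd k _ _
    let β₁ : A →ₗ[k] (V ⟶ M⟦(1 : ℤ)⟧) := (Linear.leftComp k _ iV).comp δ
    let β₂ : A →ₗ[k] (V ⟶ U⟦(1 : ℤ)⟧) ⧸ killed k T V (U⟦(1 : ℤ)⟧) :=
      (Submodule.mkQ _).comp ((Linear.leftComp k _ iV).comp (LinearMap.fst k _ _))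
    let β₃ : A →ₗ[k] (L ⟶ M⟦(1 : ℤ)⟧) ⧸ killed k (T⟦(1 : ℤ)⟧) L (M⟦(1 : ℤ)⟧) :=
      (Submodule.mkQ _).comp δ
    let β := β₁.prod (β₂.prod β₃)
    let lam : A →ₗ[k] k := (φ M L ε').comp (LinearMap.snd k _ _)
    have hlam : lam ∈ LinearMap.range β.dualMap := by
      rw [LinearMap.range_dualMap_eq_dualAnnihilator_ker, Submodule.mem_dualAnnihilator]
      rintro ⟨f, η⟩ hker
      have hker' : β (f, η) = 0 := hker
      have h1 : iV ≫ (f ≫ iU⟦(1 : ℤ)⟧' - η) = 0 := congrArg Prod.fst hker'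
      have h2 : KilledBy T (iV ≫ f) :=
        (Submodule.Quotient.mk_eq_zero _).1 (congrArg (fun q => q.2.1) hker')
      have h3 : KilledBy (T⟦(1 : ℤ)⟧) (f ≫ iU⟦(1 : ℤ)⟧' - η) :=
        (Submodule.Quotient.mk_eq_zero _).1 (congrArg (fun q => q.2.2) hker')
      change φ M L ε' η = 0
      obtain ⟨c, rfl⟩ := hgen η
      by_cases hc : c = 0
      · rw [hc, zero_smul, map_zero]
      have hsub : (c⁻¹ • f) ≫ iU⟦(1 : ℤ)⟧' - ε = c⁻¹ • (f ≫ iU⟦(1 : ℤ)⟧' - c • ε) := by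
        rw [smul_sub, smul_smul, inv_mul_cancel₀ hc, one_smul, Linear.smul_comp]
      refine absurd ?_ (hno (c⁻¹ • f) ?_ ?_)
      · rw [hsub]
        exact (killed k _ _ _).smul_mem _ h3
      · rw [Category.assoc, eq_comm, ← sub_eq_zero, ← Preadditive.comp_sub, hsub,
          Linear.comp_smul, h1, smul_zero]
      · rw [Linear.comp_smul]
        exact (killed k _ _ _).smul_mem _ h2
    obtain ⟨μ, hμ⟩ := hlam
    -- The three components of μ are represented by morphisms through φ; the last two, defined on
    -- quotients, are orthogonal to the annihilated morphisms.
    obtain ⟨x, hx⟩ := (φ M V).surjective (μ.comp (LinearMap.inl k _ _))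
    obtain ⟨y, hy⟩ := (φ U V).surjective
      ((μ.comp ((LinearMap.inr k _ _).comp (LinearMap.inl k _ _))).comp (Submodule.mkQ _))
    obtain ⟨z, hz⟩ := (φ M L).surjective
      ((μ.comp ((LinearMap.inr k _ _).comp (LinearMap.inr k _ _))).comp (Submodule.mkQ _))
    have hsum : ∀ f η, φ M L ε' η = φ M V x (iV ≫ (f ≫ iU⟦(1 : ℤ)⟧' - η)) +
        (φ U V y (iV ≫ f) + φ M L z (f ≫ iU⟦(1 : ℤ)⟧' - η)) := fun f η => by
      rw [hx, hy, hz]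
      have : φ M L ε' η = μ (β (f, η)) := (LinearMap.congr_fun hμ (f, η)).symm
      rw [this]
      simp only [LinearMap.comp_apply, ← map_add]
      refine congrArg μ (Prod.ext ?_ (Prod.ext ?_ ?_))
      · change _ = iV ≫ (f ≫ iU⟦(1 : ℤ)⟧' - η) + 0
        rw [add_zero]
        rfl
      · change _ = 0 + (Submodule.mkQ _ (iV ≫ f) + 0)
        rw [add_zero, zero_add]
        rfl
      · change _ = 0 + (0 + Submodule.mkQ _ (f ≫ iU⟦(1 : ℤ)⟧' - η))
        rw [zero_add, zero_add]
        rfl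
    -- Setting f = 0 in `hsum` gives this relation, hence (c) for Δ' with -x; setting η = f ≫ ΣiU
    -- next gives (a) with y.
    have hxz : ε' = -(x ≫ iV⟦(1 : ℤ)⟧') - z := (φ M L).injective (by
      ext η
      have := hsum 0 η
      simp only [zero_comp, comp_zero, map_zero, zero_sub, zero_add, Preadditive.comp_neg,
        map_neg] at this
      rw [this, map_sub, map_neg, LinearMap.sub_apply, LinearMap.neg_apply, pairing_postcomp hφ]
      ring)
    have hyz : y ≫ iV⟦(1 : ℤ)⟧' = iU ≫ ε' := (φ U L).injective (by
      ext f
      have := hsum f (f ≫ iU⟦(1 : ℤ)⟧')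
      simp only [sub_self, comp_zero, map_zero, zero_add, add_zero] at this
      rw [pairing_postcomp hφ, pairing_precomp hφ, this])
    refine ⟨y, -x, hyz.symm, killedBy_of_pairing_eq_zero hφ hT fun b hb => ?_, ?_⟩
    · rw [hy, LinearMap.comp_apply, Submodule.mkQ_apply,
        (Submodule.Quotient.mk_eq_zero _).2 (show b ∈ killed k T _ _ from hb), map_zero]
    · have : (-x) ≫ iV⟦(1 : ℤ)⟧' - ε' = z := by
        rw [hxz, Preadditive.neg_comp, sub_sub_cancel]
      rw [this]
      refine killedBy_of_pairing_eq_zero hφ hT.shift fun b hb => ?_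
      rw [hz, LinearMap.comp_apply, Submodule.mkQ_apply,
        (Submodule.Quotient.mk_eq_zero _).2 (show b ∈ killed k _ _ _ from hb), map_zero]

end Duality

end TwoCY

end


theorem proposition4p3 {k : Type w} [Field k] [IsAlgClosed k]
    {C : Type u} [Category.{v} C] [Preadditive C] [Linear k C] [HasZeroObject C]
    [HasShift C ℤ] [∀ n : ℤ, (shiftFunctor C n).Additive]
    [∀ n : ℤ, (shiftFunctor C n).Linear k] [Pretriangulated C] [IsTriangulated C]
    [IsIdempotentComplete C]
    (hfin : ∀ X Y : C, Module.Finite k (X ⟶ Y))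
    (hCY : TwoCY.IsTwoCalabiYau k C)
    (T : C) (hT : TwoCY.IsClusterTilting T)
    {L M B B' : C} (hdim : Module.finrank k (L ⟶ M⟦(1 : ℤ)⟧) = 1)
    (i : M ⟶ B) (p : B ⟶ L) (ε : L ⟶ M⟦(1 : ℤ)⟧)
    (hΔ : Triangle.mk i p ε ∈ distTriang C) (hε : ε ≠ 0)
    (i' : L ⟶ B') (p' : B' ⟶ M) (ε' : M ⟶ L⟦(1 : ℤ)⟧)
    (hΔ' : Triangle.mk i' p' ε' ∈ distTriang C) (hε' : ε' ≠ 0)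
    {U V : C} (iU : U ⟶ M) (iV : V ⟶ L)
    (hU : Mono ((TwoCY.F T).map iU)) (hV : Mono ((TwoCY.F T).map iV)) :
    List.TFAE [TwoCY.CondI T i p iU iV, TwoCY.CondII T ε iU iV, TwoCY.CondIII T ε iU iV] ∧
    List.TFAE [TwoCY.CondI T i' p' iV iU, TwoCY.CondII T ε' iV iU, TwoCY.CondIII T ε' iV iU] ∧
    (TwoCY.CondI T i p iU iV ↔ ¬ TwoCY.CondI T i' p' iV iU) ∧
    (TwoCY.CondII T ε iU iV ↔ ¬ TwoCY.CondII T ε' iV iU) ∧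
    (TwoCY.CondIII T ε iU iV ↔ ¬ TwoCY.CondIII T ε' iV iU) := by
  have hp := hT.hasPresentations hfin hCY
  have hp' := hT.shift.hasPresentations hfin hCY
  have h := TwoCY.condI_condII_condIII_tfae hCY hT hp hp' hΔ hU hV
  have h' := TwoCY.condI_condII_condIII_tfae hCY hT hp hp' hΔ' hV hU
  have h₃₂ := TwoCY.condIII_iff_not_condII hCY hT hp hp' hdim hε hε' iU iV
  refine ⟨h, h', ?_, ?_, ?_⟩
  · exact (h.out 0 2).trans (h₃₂.trans (not_congr (h'.out 1 0)))
  · exact (h.out 1 2).trans h₃₂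
  · exact h₃₂.trans (not_congr (h'.out 1 2))
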